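/- Let $n\in\mathbb N$, let $X\subset\mathbb R^n$ be open, let $T>0$, and let $F\in C^3(X\times(0,T);\mathbb R^n)$. Then there is a set $N\subset\mathbb R^n\times\mathbb M^{n\times n}$, where $\mathbb M^{n\times n}$ denotes the space of real $n\times n$ matrices, such that $N$ is meagre (contained in a countable union of nowhere dense sets), $N$ has zero Lebesgue measure, and for every $(y,K)\in(\mathbb R^n\times\mathbb M^{n\times n})\setminus N$ the map $$\tilde F:X\times(0,T)\to\mathbb R^n,\qquad \tilde F(x,t):=F(x,t)+y+Kx$$ satisfies the transversality conditions. This means that at every singular point of $\tilde F$, i.e. at every $(x_0,t_0)\in X\times(0,T)$ such that $\tilde F(x_0,t_0)=0$ and the partial differential $A:=\mathrm D_x\tilde F(x_0,t_0)$ is not invertible, the following hold: - (T1) $\dim\ker A=1$; - (T2) $\langle\partial_t\tilde F(x_0,t_0),w\rangle\neq0$ for every $0\neq w\in\ker A^*$; - (T3) $\langle \mathrm D_x^2\tilde F(x_0,t_0)[v,v],w\rangle\neq0$ for every $0\neq v\in\ker A$ and every $0\neq w\in\ker A^*$, where $A^*$ denotes the transpose of $A$. -/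

import Mathlib

open Set MeasureTheory

noncomputable section

namespace Transversality

/-- The Euclidean space `ℝⁿ`. -/
abbrev E (n : ℕ) : Type := EuclideanSpace ℝ (Fin n)

/-- The partial (Fréchet) differential `D_x F(x,t)`. -/
def DxF {n : ℕ} (F : E n × ℝ → E n) (x : E n) (t : ℝ) : E n →L[ℝ] E n :=
  fderiv ℝ (fun x' : E n => F (x', t)) x

/-- The second partial differential `D_x² F(x,t)`, the derivative of `D_x F(·,t)` at `x`,
as a curried bilinear map. -/
def DxxF {n : ℕ} (F : E n × ℝ → E n) (x : E n) (t : ℝ) : E n →L[ℝ] E n →L[ℝ] E n :=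
  fderiv ℝ (fun x' : E n => DxF F x' t) x

/-- The partial derivative `∂_t F(x,t)`. -/
def dtF {n : ℕ} (F : E n × ℝ → E n) (x : E n) (t : ℝ) : E n :=
  deriv (fun s : ℝ => F (x, s)) t

/-- The zero set `C` of `F` in `X × (0,T)`. -/
def zeroSet {n : ℕ} (X : Set (E n)) (T : ℝ) (F : E n × ℝ → E n) : Set (E n × ℝ) :=
  {p | p ∈ X ×ˢ Ioo 0 T ∧ F p = 0}

/-- The singular set `S`: the zeros of `F` at which `D_x F` is not invertible. -/
def singularSet {n : ℕ} (X : Set (E n)) (T : ℝ) (F : E n × ℝ → E n) : Set (E n × ℝ) :=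
  {p | p ∈ zeroSet X T F ∧ ¬ (DxF F p.1 p.2).IsInvertible}

/-- The transversality conditions (T1), (T2), (T3) at the point `(x,t)`. -/
structure TransversalAt {n : ℕ} (F : E n × ℝ → E n) (x : E n) (t : ℝ) : Prop where
  T1 : Module.finrank ℝ (LinearMap.ker (DxF F x t).toLinearMap) = 1
  T2 : ∀ w : E n, w ≠ 0 → (DxF F x t).adjoint w = 0 → inner ℝ (dtF F x t) w ≠ 0
  T3 : ∀ w : E n, w ≠ 0 → (DxF F x t).adjoint w = 0 →
    ∀ v : E n, v ≠ 0 → DxF F x t v = 0 → inner ℝ (DxxF F x t v v) w ≠ 0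

/-- `F` satisfies the transversality conditions on `X × (0,T)` if they hold at every
singular point. -/
def SatisfiesTransversality {n : ℕ} (X : Set (E n)) (T : ℝ) (F : E n × ℝ → E n) : Prop :=
  ∀ p ∈ singularSet X T F, TransversalAt F p.1 p.2

/-- The perturbed map `(x,t) ↦ F(x,t) + y + K x`. -/
def perturb {n : ℕ} (F : E n × ℝ → E n) (y : E n) (K : Matrix (Fin n) (Fin n) ℝ) :
    E n × ℝ → E n :=
  fun p => F p + y + Matrix.toEuclideanCLM (𝕜 := ℝ) K p.1

/-- A subset of `ℝⁿ × M^{n×n}` has zero Lebesgue measure; matrices are identified with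
their families of `n²` entries, on which the Lebesgue measure is the product measure. -/
def IsLebesgueNull {n : ℕ} (N : Set (E n × Matrix (Fin n) (Fin n) ℝ)) : Prop :=
  (volume : Measure (E n × (Fin n → Fin n → ℝ)))
    {p | ((p.1, Matrix.of p.2) : E n × Matrix (Fin n) (Fin n) ℝ) ∈ N} = 0

end Transversality

end

/-!
Write `A = D_x F(x,t) + K`. If the perturbed map has a singular point at `(x,t)`, then `A v = 0` for
some `v ≠ 0`, and `v` can be scaled so that some entry `v j` equals one. Such data are determined by
`x`, `t`, the remaining `n - 1` entries of `v` and the columns of `K` other than the `j`-th: the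
`j`-th column of `K` is solved from `A v = 0`, and `y` from `F(x,t) + y + K x = 0`. These are
`n + n ^ 2` free variables, as many as there are parameters `(y, K)`, and `chartMap F j` is the
resulting `C¹` map between spaces of equal dimension. By the easy, equidimensional case of Sard's
theorem its critical values form a null set; this set is also a countable union of compact sets,
hence meagre (`measure_image_criticalSet`, `isMeagre_image_criticalSet`). The exceptional set is the
union over `j` of these sets of critical values.

It remains to see that a degenerate singular point is a critical point of a chart. If (T2) fails
for `w`, the identity `F + y + K x = 0` shows that `⟨δy + δK x, w⟩ = 0` for all `(δy, δK)` in the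
image of the differential, which is therefore not surjective
(`inner_dtF_ne_zero_of_det_ne_zero`). Condition (T1) follows from (T2), because a kernel of `A*` of
dimension at least two contains a nonzero vector orthogonal to `∂_t F`
(`finrank_ker_le_one_of_inner_ne_zero`). If (T1) holds and (T3) fails, `D_x² F[v, v]` lies in the
range of `A`, and the variation `δx = v`, `δt = 0`, together with `δv` such that
`A δv = -D_x² F[v, v]` and `δv j = 0`, leaves `(y, K)` fixed to first order, so that the
differential is not injective (`inner_DxxF_ne_zero_of_det_ne_zero`).
-/

open Set MeasureTheory

noncomputable section

namespace Transversality

/-! ### Critical values of maps between spaces of equal dimension -/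

/-- A continuous image of a relatively closed subset of an open set is `σ`-compact. -/
theorem isSigmaCompact_image_of_isClosed_preimage {V W : Type*} [NormedAddCommGroup V]
    [NormedSpace ℝ V] [FiniteDimensional ℝ V] [TopologicalSpace W] {U C : Set V} {f : V → W}
    (hU : IsOpen U) (hf : ContinuousOn f U) (hCU : C ⊆ U)
    (hC : IsClosed ((↑) ⁻¹' C : Set U)) : IsSigmaCompact (f '' C) := by
  have : ProperSpace V := FiniteDimensional.proper ℝ V
  have : LocallyCompactSpace U := hU.locallyCompactSpace
  have : SigmaCompactSpace U := inferInstance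
  have h1 : IsSigmaCompact ((↑) ⁻¹' C : Set U) :=
    isSigmaCompact_univ.of_isClosed_subset hC (subset_univ _)
  have h2 := h1.image hf.domRestrict
  convert h2 using 1
  ext y
  constructor
  · rintro ⟨x, hx, rfl⟩
    exact ⟨⟨x, hCU hx⟩, hx, rfl⟩
  · rintro ⟨x, hx, rfl⟩
    exact ⟨x, hx, rfl⟩

theorem _root_.IsSigmaCompact.isMeagre_of_measure_eq_zero {W : Type*} [TopologicalSpace W]
    [T2Space W] [MeasurableSpace W] {μ : Measure W} [μ.IsOpenPosMeasure] {s : Set W}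
    (hs : IsSigmaCompact s) (h0 : μ s = 0) : IsMeagre s := by
  obtain ⟨K, hK, rfl⟩ := hs
  refine isMeagre_iUnion fun i => IsNowhereDense.isMeagre ?_
  exact IsNowhereDense.of_isClosed_null (hK i).isClosed
    (measure_mono_null (subset_iUnion K i) h0)

/-- The set of critical points in `U` of a map between spaces of equal dimension. -/
def criticalSet {V : Type*} [NormedAddCommGroup V] [NormedSpace ℝ V] (f : V → V) (U : Set V) :
    Set V :=
  {p | p ∈ U ∧ (fderiv ℝ f p).det = 0}

section
variable {V : Type*} [NormedAddCommGroup V] [NormedSpace ℝ V] [FiniteDimensional ℝ V]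
  [MeasurableSpace V] [BorelSpace V] {f : V → V} {U : Set V}

theorem measure_image_criticalSet (μ : Measure V) [μ.IsAddHaarMeasure] (hU : IsOpen U)
    (hf : ContDiffOn ℝ 1 f U) : μ (f '' criticalSet f U) = 0 := by
  refine addHaar_image_eq_zero_of_det_fderivWithin_eq_zero μ (f' := fderiv ℝ f) ?_ fun x hx => hx.2
  intro x hx
  exact (((hf.differentiableOn one_ne_zero).differentiableAt
    (hU.mem_nhds hx.1)).hasFDerivAt).hasFDerivWithinAt

theorem isMeagre_image_criticalSet (hU : IsOpen U)
    (hf : ContDiffOn ℝ 1 f U) : IsMeagre (f '' criticalSet f U) := by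
  refine IsSigmaCompact.isMeagre_of_measure_eq_zero (μ := Measure.addHaar)
    (isSigmaCompact_image_of_isClosed_preimage hU hf.continuousOn (fun _ h => h.1) ?_)
    (measure_image_criticalSet _ hU hf)
  have h1 : Continuous fun p : U => (fderiv ℝ f p).det :=
    ContinuousLinearMap.continuous_det.comp
      (hf.continuousOn_fderiv_of_isOpen hU le_rfl).domRestrict
  have h2 : ((↑) ⁻¹' criticalSet f U : Set U) = {p : U | (fderiv ℝ f p).det = 0} := by
    ext p
    simp [criticalSet]
  rw [h2]
  exact isClosed_eq h1 continuous_const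
end

/-! ### Operators of corank one -/

section
variable {H : Type*} [NormedAddCommGroup H] [InnerProductSpace ℝ H] [FiniteDimensional ℝ H]

theorem finrank_ker_adjoint_eq (A : H →L[ℝ] H) :
    Module.finrank ℝ (LinearMap.ker A.adjoint.toLinearMap) =
      Module.finrank ℝ (LinearMap.ker A.toLinearMap) := by
  have h1 := A.orthogonal_range
  have h2 := LinearMap.finrank_range_add_finrank_ker A.toLinearMap
  have h3 := Submodule.finrank_add_finrank_orthogonal (LinearMap.range A.toLinearMap)
  rw [h1] at h3
  omega

/-- If no nonzero vector of `ker A*` is orthogonal to `b`, pairing with `b` embeds `ker A*` in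
`ℝ`, so that `A` has corank at most one. -/
theorem finrank_ker_le_one_of_inner_ne_zero {A : H →L[ℝ] H} {b : H}
    (h : ∀ w : H, w ≠ 0 → A.adjoint w = 0 → inner ℝ b w ≠ 0) :
    Module.finrank ℝ (LinearMap.ker A.toLinearMap) ≤ 1 := by
  rw [← finrank_ker_adjoint_eq]
  let φ : LinearMap.ker A.adjoint.toLinearMap →ₗ[ℝ] ℝ :=
    (innerₗ H b).comp (Submodule.subtype _)
  have hφ : Function.Injective φ := by
    rw [← LinearMap.ker_eq_bot, LinearMap.ker_eq_bot']
    rintro ⟨w, hw⟩ hw0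
    by_contra hne
    exact h w (fun h0 => hne (Subtype.ext h0)) hw hw0
  simpa using LinearMap.finrank_le_finrank_of_injective hφ

theorem mem_range_of_inner_eq_zero {A : H →L[ℝ] H}
    (hA : Module.finrank ℝ (LinearMap.ker A.toLinearMap) ≤ 1) {w z : H} (hw0 : w ≠ 0)
    (hw : A.adjoint w = 0) (hz : inner ℝ z w = 0) : ∃ u, A u = z := by
  rw [← finrank_ker_adjoint_eq] at hA
  suffices h : z ∈ LinearMap.range A.toLinearMap from h
  rw [← Submodule.orthogonal_orthogonal (LinearMap.range A.toLinearMap), A.orthogonal_range,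
    Submodule.mem_orthogonal']
  intro w' hw'
  obtain ⟨c, hc⟩ := (finrank_le_one_iff.1 hA)
  obtain ⟨a, ha⟩ := hc ⟨w, hw⟩
  obtain ⟨a', ha'⟩ := hc ⟨w', hw'⟩
  have e1 : a • (c : H) = w := congrArg Subtype.val ha
  have e2 : a' • (c : H) = w' := congrArg Subtype.val ha'
  have ha0 : a ≠ 0 := by rintro rfl; exact hw0 (by simpa using e1.symm)
  rw [← e1, inner_smul_right] at hz
  rw [← e2, inner_smul_right, (mul_eq_zero.1 hz).resolve_left ha0, mul_zero]

theorem exists_ne_zero_of_not_isInvertible {A : H →L[ℝ] H} (hA : ¬ A.IsInvertible) :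
    ∃ v, v ≠ 0 ∧ A v = 0 := by
  by_contra! h
  refine hA ?_
  have hinj : Function.Injective A.toLinearMap := by
    rw [← LinearMap.ker_eq_bot, LinearMap.ker_eq_bot']
    intro v hv
    by_contra hv0
    exact h v hv0 hv
  refine ⟨(LinearEquiv.ofInjectiveEndo A.toLinearMap hinj).toContinuousLinearEquiv, ?_⟩
  ext v
  rfl

theorem bijective_of_det_ne_zero {V : Type*} [NormedAddCommGroup V] [NormedSpace ℝ V]
    [FiniteDimensional ℝ V] {A : V →L[ℝ] V} (hA : A.det ≠ 0) : Function.Bijective A :=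
  (LinearMap.equivOfDetNeZero A.toLinearMap hA).bijective
end

variable {n : ℕ}

/-! ### Partial derivatives of the map and of its perturbations -/

section PartialDerivatives
variable {X : Set (E n)} {T : ℝ} {F : E n × ℝ → E n}

theorem isOpen_prod_Ioo (hX : IsOpen X) : IsOpen (X ×ˢ Ioo 0 T) := hX.prod isOpen_Ioo

theorem DxF_eq_comp_inl {x : E n} {t : ℝ} (h : DifferentiableAt ℝ F (x, t)) :
    DxF F x t = (fderiv ℝ F (x, t)).comp (ContinuousLinearMap.inl ℝ (E n) ℝ) := by
  have h1 : HasFDerivAt (fun x' : E n => (x', t)) (ContinuousLinearMap.inl ℝ (E n) ℝ) x :=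
    hasFDerivAt_prodMk_left x t
  exact (HasFDerivAt.comp x h.hasFDerivAt h1).fderiv

theorem dtF_eq_fderiv {x : E n} {t : ℝ} (h : DifferentiableAt ℝ F (x, t)) :
    dtF F x t = fderiv ℝ F (x, t) (0, 1) := by
  have h1 : HasDerivAt (fun s : ℝ => (x, s)) ((0 : E n), (1 : ℝ)) t :=
    (hasDerivAt_const t x).prodMk (hasDerivAt_id t)
  exact (h.hasFDerivAt.comp_hasDerivAt t h1).deriv

theorem fderiv_apply_eq_DxF_add_dtF {x : E n} {t : ℝ} (h : DifferentiableAt ℝ F (x, t))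
    (ξ : E n) (τ : ℝ) : fderiv ℝ F (x, t) (ξ, τ) = DxF F x t ξ + τ • dtF F x t := by
  rw [DxF_eq_comp_inl h, dtF_eq_fderiv h, ContinuousLinearMap.comp_apply, ← map_smul, ← map_add]
  simp

theorem contDiffOn_DxF (hX : IsOpen X) (hF : ContDiffOn ℝ 2 F (X ×ˢ Ioo 0 T)) :
    ContDiffOn ℝ 1 (fun p : E n × ℝ => DxF F p.1 p.2) (X ×ˢ Ioo 0 T) := by
  have h1 : ContDiffOn ℝ 1 (fderiv ℝ F) (X ×ˢ Ioo 0 T) :=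
    hF.fderiv_of_isOpen (isOpen_prod_Ioo hX) (by norm_num)
  refine (h1.clm_comp (contDiffOn_const (c := ContinuousLinearMap.inl ℝ (E n) ℝ))).congr ?_
  rintro ⟨x, t⟩ hp
  exact DxF_eq_comp_inl ((hF.differentiableOn two_ne_zero).differentiableAt
    ((isOpen_prod_Ioo hX).mem_nhds hp))

theorem DxxF_apply {x : E n} {t : ℝ}
    (h : DifferentiableAt ℝ (fun p : E n × ℝ => DxF F p.1 p.2) (x, t)) (ξ : E n) :
    DxxF F x t ξ = fderiv ℝ (fun p : E n × ℝ => DxF F p.1 p.2) (x, t) (ξ, 0) := by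
  have h1 : HasFDerivAt (fun x' : E n => (x', t)) (ContinuousLinearMap.inl ℝ (E n) ℝ) x :=
    hasFDerivAt_prodMk_left x t
  have h2 := (HasFDerivAt.comp x h.hasFDerivAt h1).fderiv
  have h3 : DxxF F x t = _ := h2
  rw [h3]
  simp

variable (y : E n) (K : Matrix (Fin n) (Fin n) ℝ)

theorem dtF_perturb {x : E n} {t : ℝ} : dtF (perturb F y K) x t = dtF F x t := by
  simp only [dtF, perturb]
  rw [deriv_add_const, deriv_add_const]

theorem DxF_perturb {x : E n} {t : ℝ} (h : DifferentiableAt ℝ F (x, t)) :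
    DxF (perturb F y K) x t = DxF F x t + Matrix.toEuclideanCLM (𝕜 := ℝ) K := by
  have h1 : DifferentiableAt ℝ (fun x' : E n => F (x', t)) x :=
    h.comp x (hasFDerivAt_prodMk_left (𝕜 := ℝ) x t).differentiableAt
  exact ((h1.hasFDerivAt.add_const y).add
    (Matrix.toEuclideanCLM (𝕜 := ℝ) K).hasFDerivAt).fderiv

theorem DxxF_perturb (hX : IsOpen X) (hF : DifferentiableOn ℝ F (X ×ˢ Ioo 0 T))
    {x : E n} {t : ℝ} (hx : x ∈ X) (ht : t ∈ Ioo 0 T) :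
    DxxF (perturb F y K) x t = DxxF F x t := by
  have h1 : (fun x' => DxF (perturb F y K) x' t) =ᶠ[nhds x]
      fun x' => DxF F x' t + Matrix.toEuclideanCLM (𝕜 := ℝ) K := by
    filter_upwards [hX.mem_nhds hx] with x' hx'
    exact DxF_perturb y K (hF.differentiableAt ((isOpen_prod_Ioo hX).mem_nhds ⟨hx', ht⟩))
  rw [DxxF, h1.fderiv_eq, fderiv_add_const, DxxF]
end PartialDerivatives

/-! ### Charts of the parameters with a singular point -/

/-- The array of entries of a matrix, as the operator it induces on `ℝⁿ`. -/
def entriesToCLM (n : ℕ) : (Fin n → Fin n → ℝ) →L[ℝ] (E n →L[ℝ] E n) :=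
  LinearMap.toContinuousLinearMap
    { toFun := fun M => Matrix.toEuclideanCLM (𝕜 := ℝ) (Matrix.of M)
      map_add' := fun M M' => map_add (Matrix.toEuclideanCLM (𝕜 := ℝ)) (Matrix.of M) (Matrix.of M')
      map_smul' := fun c M => map_smul (Matrix.toEuclideanCLM (𝕜 := ℝ)) c (Matrix.of M) }

theorem entriesToCLM_apply (M : Fin n → Fin n → ℝ) (v : E n) (i : Fin n) :
    entriesToCLM n M v i = ∑ k, M i k * v k := rfl

/-- The `j`-th column of `M` with its `j`-th entry replaced by zero. -/
def offDiagCol (j : Fin n) : (Fin n → Fin n → ℝ) →L[ℝ] E n :=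
  LinearMap.toContinuousLinearMap
    { toFun := fun M => WithLp.toLp 2 fun i => if i = j then 0 else M i j
      map_add' := fun M M' => by
        ext i
        by_cases h : i = j <;> simp [h]
      map_smul' := fun c M => by
        ext i
        by_cases h : i = j <;> simp [h] }

theorem offDiagCol_apply (j : Fin n) (M : Fin n → Fin n → ℝ) (i : Fin n) :
    offDiagCol j M i = if i = j then 0 else M i j := rfl

/-- The kernel vector encoded by the `j`-th column of `M`: its `j`-th entry is normalised to one,
the others are those of `M`. -/
def chartVec (j : Fin n) (M : Fin n → Fin n → ℝ) : E n :=
  offDiagCol j M + EuclideanSpace.single j 1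

theorem chartVec_apply (j : Fin n) (M : Fin n → Fin n → ℝ) (i : Fin n) :
    chartVec j M i = if i = j then 1 else M i j := by
  by_cases h : i = j <;> simp [chartVec, offDiagCol_apply, h]

/-- The matrix that agrees with `M` outside column `j`, and whose column `j` is the one for which
`D_x F + K` annihilates `chartVec j M`. -/
def chartMat (F : E n × ℝ → E n) (j : Fin n) (q : E n × (Fin n → Fin n → ℝ)) :
    Fin n → Fin n → ℝ :=
  fun i k => if k = j then
    -(DxF F q.1 (q.2 j j) (chartVec j q.2) i + ∑ l ∈ Finset.univ.erase j, q.2 i l * q.2 l j)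
  else q.2 i k

/-- A parametrisation of the parameters `(y, K)` for which the perturbed map has a singular point
whose kernel contains a vector with nonzero `j`-th entry. The array `M = q.2` encodes the time
`M j j`, the kernel vector `chartVec j M`, and the columns of `K` other than the `j`-th; the rest
of `K` and `y` are solved for. Domain and target have the same dimension. -/
def chartMap (F : E n × ℝ → E n) (j : Fin n) (q : E n × (Fin n → Fin n → ℝ)) :
    E n × (Fin n → Fin n → ℝ) :=
  (-F (q.1, q.2 j j) - entriesToCLM n (chartMat F j q) q.1, chartMat F j q)

/-- The points of the chart that lie over `X × (0,T)`. -/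
def chartDomain (X : Set (E n)) (T : ℝ) (j : Fin n) : Set (E n × (Fin n → Fin n → ℝ)) :=
  {q | (q.1, q.2 j j) ∈ X ×ˢ Ioo 0 T}

/-- The point of `X × (0,T)` underlying a point of the chart. -/
def chartBase (j : Fin n) : E n × (Fin n → Fin n → ℝ) →L[ℝ] E n × ℝ :=
  (ContinuousLinearMap.fst ℝ _ _).prod
    (((ContinuousLinearMap.proj j : (Fin n → ℝ) →L[ℝ] ℝ).comp
      (ContinuousLinearMap.proj j : (Fin n → Fin n → ℝ) →L[ℝ] (Fin n → ℝ))).comp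
        (ContinuousLinearMap.snd ℝ _ _))

theorem chartBase_apply (j : Fin n) (q : E n × (Fin n → Fin n → ℝ)) :
    chartBase j q = (q.1, q.2 j j) := rfl

section Chart
variable {X : Set (E n)} {T : ℝ} {F : E n × ℝ → E n} {j : Fin n}

theorem isOpen_chartDomain (hX : IsOpen X) : IsOpen (chartDomain X T j) :=
  (isOpen_prod_Ioo hX).preimage (chartBase j).continuous

theorem contDiffOn_chartMat (hX : IsOpen X) (hF : ContDiffOn ℝ 2 F (X ×ˢ Ioo 0 T)) :
    ContDiffOn ℝ 1 (chartMat F j) (chartDomain X T j) := by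
  have hD : ContDiffOn ℝ 1 (fun q : E n × (Fin n → Fin n → ℝ) => DxF F q.1 (q.2 j j))
      (chartDomain X T j) :=
    (contDiffOn_DxF hX hF).comp (chartBase j).contDiff.contDiffOn fun q hq => hq
  have hv : ContDiff ℝ 1 fun q : E n × (Fin n → Fin n → ℝ) => chartVec j q.2 :=
    ((offDiagCol j).contDiff.comp contDiff_snd).add contDiff_const
  have hM : ∀ i k, ContDiff ℝ 1 fun q : E n × (Fin n → Fin n → ℝ) => q.2 i k := fun i k => by
    fun_prop
  refine contDiffOn_pi.2 fun i => contDiffOn_pi.2 fun k => ?_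
  by_cases hk : k = j
  · simp only [chartMat, hk, if_true]
    refine (ContDiffOn.add ?_ ?_).neg
    · exact (EuclideanSpace.proj i : E n →L[ℝ] ℝ).contDiff.comp_contDiffOn
        (hD.clm_apply hv.contDiffOn)
    · exact (ContDiff.sum fun l _ => (hM i l).mul (hM l j)).contDiffOn
  · simp only [chartMat, hk, if_false]
    exact (hM i k).contDiffOn

theorem contDiffOn_chartMap (hX : IsOpen X) (hF : ContDiffOn ℝ 2 F (X ×ˢ Ioo 0 T)) :
    ContDiffOn ℝ 1 (chartMap F j) (chartDomain X T j) := by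
  have hK := contDiffOn_chartMat (j := j) hX hF
  have hF1 : ContDiffOn ℝ 1 (fun q : E n × (Fin n → Fin n → ℝ) => F (q.1, q.2 j j))
      (chartDomain X T j) :=
    (hF.of_le one_le_two).comp (chartBase j).contDiff.contDiffOn fun q hq => hq
  refine ContDiffOn.prodMk (hF1.neg.sub ?_) hK
  exact ((entriesToCLM n).contDiff.comp_contDiffOn hK).clm_apply contDiffOn_fst

theorem chartMat_annihilates (F : E n × ℝ → E n) (j : Fin n)
    (q : E n × (Fin n → Fin n → ℝ)) :
    DxF F q.1 (q.2 j j) (chartVec j q.2) +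
      entriesToCLM n (chartMat F j q) (chartVec j q.2) = 0 := by
  ext i
  have h : ∑ k ∈ Finset.univ.erase j, chartMat F j q i k * chartVec j q.2 k =
      ∑ l ∈ Finset.univ.erase j, q.2 i l * q.2 l j := by
    refine Finset.sum_congr rfl fun k hk => ?_
    have hk : k ≠ j := Finset.ne_of_mem_erase hk
    simp [chartMat, chartVec_apply, hk]
  have hj : chartMat F j q i j * chartVec j q.2 j = -(DxF F q.1 (q.2 j j) (chartVec j q.2) i +
      ∑ l ∈ Finset.univ.erase j, q.2 i l * q.2 l j) := by
    simp [chartMat, chartVec_apply]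
  rw [PiLp.add_apply, entriesToCLM_apply, ← Finset.add_sum_erase _ _ (Finset.mem_univ j), h, hj,
    PiLp.zero_apply]
  ring

/-- The array in the `j`-th chart encoding the time `t`, the kernel vector `v` and the matrix
`K`. -/
def chartEntries (j : Fin n) (t : ℝ) (v : E n) (K : Fin n → Fin n → ℝ) : Fin n → Fin n → ℝ :=
  fun i k => if k = j then (if i = j then t else v i) else K i k

/-- A zero `(x, t)` of the perturbed map, with a kernel vector `v` there such that `v j = 1`, comes
from a point of the `j`-th chart. -/
theorem chartMap_chartEntries {x y v : E n} {t : ℝ} {K : Fin n → Fin n → ℝ} (hvj : v j = 1)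
    (hy : F (x, t) + y + entriesToCLM n K x = 0)
    (hv : DxF F x t v + entriesToCLM n K v = 0) :
    chartVec j (chartEntries j t v K) = v ∧
      chartMap F j (x, chartEntries j t v K) = (y, K) := by
  have h1 : chartVec j (chartEntries j t v K) = v := by
    ext i
    by_cases h : i = j
    · subst h; simp [chartVec_apply, hvj]
    · simp [chartVec_apply, chartEntries, h]
  have ht : chartEntries j t v K j j = t := by simp [chartEntries]
  have h2 : chartMat F j (x, chartEntries j t v K) = K := by
    funext i k
    by_cases h : k = j
    · subst h
      have h3 := congrArg (fun z : E n => z i) hv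
      simp only [PiLp.add_apply, entriesToCLM_apply, PiLp.zero_apply] at h3
      rw [← Finset.add_sum_erase _ _ (Finset.mem_univ k), hvj, mul_one] at h3
      have h4 : ∑ l ∈ Finset.univ.erase k, chartEntries k t v K i l * chartEntries k t v K l k =
          ∑ l ∈ Finset.univ.erase k, K i l * v l := by
        refine Finset.sum_congr rfl fun l hl => ?_
        have hl : l ≠ k := Finset.ne_of_mem_erase hl
        simp [chartEntries, hl]
      simp only [chartMat, if_true, ht, h1, h4]
      linarith
    · simp [chartMat, chartEntries, h]
  refine ⟨h1, Prod.ext ?_ h2⟩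
  simp only [chartMap, ht, h2]
  rw [sub_eq_iff_eq_add, neg_eq_iff_add_eq_zero, ← add_assoc]
  exact hy

/-! ### The differential of a chart -/

theorem hasFDerivAt_chartMap (hX : IsOpen X) (hF : ContDiffOn ℝ 2 F (X ×ˢ Ioo 0 T))
    {q : E n × (Fin n → Fin n → ℝ)} (hq : q ∈ chartDomain X T j) :
    HasFDerivAt (chartMap F j) (fderiv ℝ (chartMap F j) q) q :=
  (((contDiffOn_chartMap hX hF).differentiableOn one_ne_zero).differentiableAt
    ((isOpen_chartDomain hX).mem_nhds hq)).hasFDerivAt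

/-- Differentiating `F + y + K x = 0` along the chart. -/
theorem fderiv_chartMap_fst (hX : IsOpen X) (hF : ContDiffOn ℝ 2 F (X ×ˢ Ioo 0 T))
    {q : E n × (Fin n → Fin n → ℝ)} (hq : q ∈ chartDomain X T j)
    (h : E n × (Fin n → Fin n → ℝ)) :
    (fderiv ℝ (chartMap F j) q h).1 + entriesToCLM n (fderiv ℝ (chartMap F j) q h).2 q.1 =
      -((DxF F q.1 (q.2 j j) + entriesToCLM n (chartMat F j q)) h.1 +
        h.2 j j • dtF F q.1 (q.2 j j)) := by
  have hG := hasFDerivAt_chartMap hX hF hq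
  have hd : DifferentiableAt ℝ F (q.1, q.2 j j) :=
    (hF.differentiableOn two_ne_zero).differentiableAt ((isOpen_prod_Ioo hX).mem_nhds hq)
  have hF' := HasFDerivAt.comp q (f := chartBase j) hd.hasFDerivAt (chartBase j).hasFDerivAt
  have h1 := (hF'.add hG.fst).add
    (((entriesToCLM n).hasFDerivAt.comp q hG.snd).clm_apply (hasFDerivAt_fst (p := q)))
  have h2 := h1.unique (f := _) ((hasFDerivAt_const (0 : E n) q).congr_of_eventuallyEq
    (Filter.Eventually.of_forall fun q' => by
      simp only [chartMap, chartBase_apply, Pi.add_apply, Function.comp_apply]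
      abel))
  have h3 := congrArg (fun L : _ →L[ℝ] E n => L h) h2
  simp [chartBase_apply, fderiv_apply_eq_DxF_add_dtF hd] at h3
  rw [eq_neg_iff_add_eq_zero, ← h3]
  simp [chartMap]
  abel

/-- Differentiating `(D_x F + K) v = 0` along the chart, in a direction in which `t` is constant. -/
theorem fderiv_chartMap_snd_apply (hX : IsOpen X) (hF : ContDiffOn ℝ 2 F (X ×ˢ Ioo 0 T))
    {q : E n × (Fin n → Fin n → ℝ)} (hq : q ∈ chartDomain X T j)
    (h : E n × (Fin n → Fin n → ℝ)) (h0 : h.2 j j = 0) :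
    entriesToCLM n (fderiv ℝ (chartMap F j) q h).2 (chartVec j q.2) =
      -(DxxF F q.1 (q.2 j j) h.1 (chartVec j q.2) +
        (DxF F q.1 (q.2 j j) + entriesToCLM n (chartMat F j q)) (offDiagCol j h.2)) := by
  have hG := hasFDerivAt_chartMap hX hF hq
  have hd : DifferentiableAt ℝ (fun p : E n × ℝ => DxF F p.1 p.2) (q.1, q.2 j j) :=
    ((contDiffOn_DxF hX hF).differentiableOn one_ne_zero).differentiableAt
      ((isOpen_prod_Ioo hX).mem_nhds hq)
  have hD := HasFDerivAt.comp q (f := chartBase j) hd.hasFDerivAt (chartBase j).hasFDerivAt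
  have hv : HasFDerivAt (fun q : E n × (Fin n → Fin n → ℝ) => chartVec j q.2)
      ((offDiagCol j).comp (ContinuousLinearMap.snd ℝ _ _)) q :=
    ((offDiagCol j).hasFDerivAt.comp q (hasFDerivAt_snd (p := q))).add_const _
  have h1 := (hD.clm_apply hv).add
    (((entriesToCLM n).hasFDerivAt.comp q hG.snd).clm_apply hv)
  have h2 := h1.unique (f := _) ((hasFDerivAt_const (0 : E n) q).congr_of_eventuallyEq
    (Filter.Eventually.of_forall fun q' => chartMat_annihilates F j q'))
  have h3 := congrArg (fun L : _ →L[ℝ] E n => L h) h2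
  simp [chartBase_apply, h0] at h3
  rw [eq_neg_iff_add_eq_zero, ← h3, DxxF_apply hd]
  simp [chartMap]
  abel

theorem fderiv_chartMap_snd_entry (hX : IsOpen X) (hF : ContDiffOn ℝ 2 F (X ×ˢ Ioo 0 T))
    {q : E n × (Fin n → Fin n → ℝ)} (hq : q ∈ chartDomain X T j)
    (h : E n × (Fin n → Fin n → ℝ)) (i : Fin n) {k : Fin n}
    (hk : k ≠ j) : (fderiv ℝ (chartMap F j) q h).2 i k = h.2 i k := by
  have h1 := hasFDerivAt_pi'.1 (hasFDerivAt_pi'.1 (hasFDerivAt_chartMap hX hF hq).snd i) k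
  have h2 : HasFDerivAt (fun q : E n × (Fin n → Fin n → ℝ) => q.2 i k) _ q :=
    hasFDerivAt_pi'.1 (hasFDerivAt_pi'.1 (hasFDerivAt_snd (𝕜 := ℝ) (p := q)) i) k
  have h3 := h1.unique (h2.congr_of_eventuallyEq
    (Filter.Eventually.of_forall fun q' => by simp [chartMap, chartMat, hk]))
  exact congrArg (fun L : _ →L[ℝ] ℝ => L h) h3

end Chart

/-! ### Transversality at regular values of the charts -/

section Regular
variable {X : Set (E n)} {T : ℝ} {F : E n × ℝ → E n} {j : Fin n}

/-- At a regular point of the chart (T2) holds: if `w` in `ker A*` were orthogonal to the time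
derivative, every vector `(η, H)` in the image of the differential would satisfy
`⟨η + H x, w⟩ = 0`. -/
theorem inner_dtF_ne_zero_of_det_ne_zero (hX : IsOpen X)
    (hF : ContDiffOn ℝ 2 F (X ×ˢ Ioo 0 T)) {q : E n × (Fin n → Fin n → ℝ)}
    (hq : q ∈ chartDomain X T j) (hdet : (fderiv ℝ (chartMap F j) q).det ≠ 0) {w : E n}
    (hw0 : w ≠ 0)
    (hw : (DxF F q.1 (q.2 j j) + entriesToCLM n (chartMat F j q)).adjoint w = 0) :
    inner ℝ (dtF F q.1 (q.2 j j)) w ≠ 0 := by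
  intro h
  -- A preimage of `(w, 0)` forces `⟨w, w⟩ = 0`.
  obtain ⟨a, ha⟩ := (bijective_of_det_ne_zero hdet).2 (w, 0)
  have h1 := fderiv_chartMap_fst hX hF hq a
  rw [ha, map_zero, _root_.zero_apply, add_zero] at h1
  refine hw0 (inner_self_eq_zero (𝕜 := ℝ).1 ?_)
  nth_rewrite 1 [show w = _ from h1]
  rw [inner_neg_left, inner_add_left, ← ContinuousLinearMap.adjoint_inner_right, hw,
    inner_smul_left, h, inner_zero_right]
  simp

/-- At a regular point of the chart where `A` has corank one, (T3) holds: otherwise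
`D_x² F[v, v]` lies in the range of `A`, and moving `x` along `v` can be compensated by moving
the kernel vector, with `K` and `y` fixed to first order. -/
theorem inner_DxxF_ne_zero_of_det_ne_zero (hX : IsOpen X)
    (hF : ContDiffOn ℝ 2 F (X ×ˢ Ioo 0 T)) {q : E n × (Fin n → Fin n → ℝ)}
    (hq : q ∈ chartDomain X T j) (hdet : (fderiv ℝ (chartMap F j) q).det ≠ 0)
    (hker : Module.finrank ℝ (LinearMap.ker
      (DxF F q.1 (q.2 j j) + entriesToCLM n (chartMat F j q)).toLinearMap) ≤ 1)
    {w : E n} (hw0 : w ≠ 0)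
    (hw : (DxF F q.1 (q.2 j j) + entriesToCLM n (chartMat F j q)).adjoint w = 0) :
    inner ℝ (DxxF F q.1 (q.2 j j) (chartVec j q.2) (chartVec j q.2)) w ≠ 0 := by
  intro h
  set v := chartVec j q.2 with hv
  have hvj : v j = 1 := by simp [hv, chartVec_apply]
  have hAv : (DxF F q.1 (q.2 j j) + entriesToCLM n (chartMat F j q)) v = 0 :=
    chartMat_annihilates F j q
  obtain ⟨u, hu⟩ := mem_range_of_inner_eq_zero hker hw0 hw h
  -- `-u` solves `A δv = -D_x² F[v, v]`; adding a multiple of `v` makes its `j`-th entry vanish.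
  let δv : E n := u j • v - u
  have hδj : δv j = 0 := by simp [δv, hvj]
  let a : E n × (Fin n → Fin n → ℝ) := (v, chartEntries j 0 δv 0)
  have ha : a.2 j j = 0 := by simp [a, chartEntries]
  have haδ : offDiagCol j a.2 = δv := by
    ext i
    by_cases hi : i = j
    · subst hi; simp [offDiagCol_apply, hδj]
    · simp [offDiagCol_apply, a, chartEntries, hi]
  have h1 := fderiv_chartMap_snd_apply hX hF hq a ha
  have h2 : entriesToCLM n (fderiv ℝ (chartMap F j) q a).2 v = 0 := by
    rw [h1, haδ, map_sub, map_smul, hAv, hu]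
    simp [a, hv]
  have h3 : ∀ i k, k ≠ j → (fderiv ℝ (chartMap F j) q a).2 i k = 0 := fun i k hk => by
    rw [fderiv_chartMap_snd_entry hX hF hq a i hk]
    simp [a, chartEntries, hk]
  have h4 : (fderiv ℝ (chartMap F j) q a).2 = 0 := by
    funext i k
    by_cases hk : k = j
    · have h5 := congrArg (fun z : E n => z i) h2
      simp only [entriesToCLM_apply, PiLp.zero_apply] at h5
      rw [Finset.sum_eq_single j (fun k _ hk => by rw [h3 i k hk, zero_mul]) (by simp), hvj,
        mul_one] at h5
      rw [hk, h5]; rfl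
    · exact h3 i k hk
  have h5 := fderiv_chartMap_fst hX hF hq a
  rw [h4, map_zero, _root_.zero_apply, add_zero, ha, zero_smul, add_zero,
    show a.1 = v from rfl, hAv, neg_zero] at h5
  have h6 : a = 0 := (bijective_of_det_ne_zero hdet).1
    ((Prod.ext h5 h4 : fderiv ℝ (chartMap F j) q a = 0).trans (map_zero _).symm)
  have h7 : v = 0 := congrArg Prod.fst h6
  rw [h7] at hvj
  simp at hvj

/-- A parameter that is a critical value of none of the charts satisfies the transversality
conditions. -/
theorem satisfiesTransversality_of_regular (hX : IsOpen X)
    (hF : ContDiffOn ℝ 2 F (X ×ˢ Ioo 0 T)) (y : E n) (K : Matrix (Fin n) (Fin n) ℝ)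
    (hreg : ∀ j, ((y, K) : E n × (Fin n → Fin n → ℝ)) ∉
      chartMap F j '' criticalSet (chartMap F j) (chartDomain X T j)) :
    SatisfiesTransversality X T (perturb F y K) := by
  rintro ⟨x, t⟩ ⟨⟨hxt, h0⟩, hsing⟩
  have hdF : DifferentiableOn ℝ F (X ×ˢ Ioo 0 T) := hF.differentiableOn two_ne_zero
  have hd : DifferentiableAt ℝ F (x, t) := hdF.differentiableAt ((isOpen_prod_Ioo hX).mem_nhds hxt)
  have hA : DxF (perturb F y K) x t = DxF F x t + entriesToCLM n K := DxF_perturb y K hd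
  have h0' : F (x, t) + y + entriesToCLM n K x = 0 := h0
  -- Every kernel vector, suitably scaled, comes from a regular point of some chart.
  have hchart : ∀ v, v ≠ 0 → DxF (perturb F y K) x t v = 0 → ∃ c : ℝ, ∃ j : Fin n,
      ∃ q ∈ chartDomain X T j, (fderiv ℝ (chartMap F j) q).det ≠ 0 ∧ q.1 = x ∧ q.2 j j = t ∧
        chartMat F j q = K ∧ v = c • chartVec j q.2 ∧ c ≠ 0 := by
    intro v hv0 hv
    obtain ⟨j, hj⟩ : ∃ j, v j ≠ 0 := by
      by_contra! h
      exact hv0 (by ext i; simp [h i])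
    have hAv : DxF F x t ((v j)⁻¹ • v) + entriesToCLM n K ((v j)⁻¹ • v) = 0 := by
      rw [← _root_.add_apply, ← hA, map_smul, hv, smul_zero]
    obtain ⟨h1, h2⟩ := chartMap_chartEntries (j := j) (by simp [hj]) h0' hAv
    have ht : chartEntries j t ((v j)⁻¹ • v) K j j = t := by simp [chartEntries]
    have hq : (x, chartEntries j t ((v j)⁻¹ • v) K) ∈ chartDomain X T j := by
      simpa only [chartDomain, mem_ofPred_eq, ht] using hxt
    refine ⟨v j, j, (x, chartEntries j t ((v j)⁻¹ • v) K), hq, fun hdet => ?_, rfl, ht,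
      congrArg Prod.snd h2, ?_, hj⟩
    · exact hreg j ⟨_, ⟨hq, hdet⟩, h2⟩
    · rw [h1, smul_smul, mul_inv_cancel₀ hj, one_smul]
  obtain ⟨v₀, hv₀, hAv₀⟩ := exists_ne_zero_of_not_isInvertible hsing
  have hT2 : ∀ w : E n, w ≠ 0 → (DxF (perturb F y K) x t).adjoint w = 0 →
      inner ℝ (dtF (perturb F y K) x t) w ≠ 0 := by
    intro w hw0 hw
    rw [hA] at hw
    rw [dtF_perturb]
    obtain ⟨c, j, q, hq, hdet, rfl, rfl, rfl, -⟩ := hchart v₀ hv₀ hAv₀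
    exact inner_dtF_ne_zero_of_det_ne_zero hX hF hq hdet hw0 hw
  have hker := finrank_ker_le_one_of_inner_ne_zero hT2
  refine ⟨le_antisymm hker ?_, hT2, ?_⟩
  · rw [Nat.one_le_iff_ne_zero, Ne, Submodule.finrank_eq_zero]
    exact fun hbot => hv₀ (LinearMap.ker_eq_bot'.1 hbot v₀ hAv₀)
  · intro w hw0 hw v hv0 hv
    rw [hA] at hw hker
    rw [DxxF_perturb _ _ hX hdF hxt.1 hxt.2]
    obtain ⟨c, j, q, hq, hdet, rfl, rfl, rfl, rfl, hc⟩ := hchart v hv0 hv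
    have h1 := inner_DxxF_ne_zero_of_det_ne_zero hX hF hq hdet hker hw0 hw
    simpa [inner_smul_left, hc] using h1

end Regular

theorem isAddHaarMeasure_volume_prod_entries (n : ℕ) :
    (volume : Measure (E n × (Fin n → Fin n → ℝ))).IsAddHaarMeasure := by
  have : (volume : Measure (Fin n → Fin n → ℝ)).IsAddHaarMeasure :=
    Measure.pi.isAddHaarMeasure (α := fun _ : Fin n => Fin n → ℝ) fun _ => volume
  exact Measure.prod.instIsAddHaarMeasure volume volume

/-- Two continuous derivatives of `F` suffice: the charts are then of class `C¹`, which is all that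
the equidimensional case of Sard's theorem requires. -/
theorem exists_isMeagre_null_forall_satisfiesTransversality {X : Set (E n)} (hX : IsOpen X)
    {T : ℝ} {F : E n × ℝ → E n} (hF : ContDiffOn ℝ 2 F (X ×ˢ Ioo 0 T)) :
    ∃ N : Set (E n × Matrix (Fin n) (Fin n) ℝ), IsMeagre N ∧ IsLebesgueNull N ∧
      ∀ (y : E n) (K : Matrix (Fin n) (Fin n) ℝ), (y, K) ∉ N →
        SatisfiesTransversality X T (perturb F y K) := by
  let N : Set (E n × (Fin n → Fin n → ℝ)) :=
    ⋃ j, chartMap F j '' criticalSet (chartMap F j) (chartDomain X T j)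
  have := isAddHaarMeasure_volume_prod_entries n
  have hmeagre : IsMeagre N := isMeagre_iUnion fun j =>
    isMeagre_image_criticalSet (isOpen_chartDomain hX) (contDiffOn_chartMap hX hF)
  have hnull : volume N = 0 := measure_iUnion_null fun j =>
    measure_image_criticalSet _ (isOpen_chartDomain hX) (contDiffOn_chartMap hX hF)
  refine ⟨N, hmeagre, hnull, fun y K hyK => ?_⟩
  exact satisfiesTransversality_of_regular hX hF y K fun j hj => hyK (mem_iUnion_of_mem j hj)

end Transversality

end

theorem mainTheorem4 (n : ℕ) (X : Set (Transversality.E n)) (hX : IsOpen X)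
    (T : ℝ) (hT : 0 < T)
    (F : Transversality.E n × ℝ → Transversality.E n)
    (hF : ContDiffOn ℝ 3 F (X ×ˢ Set.Ioo 0 T)) :
    ∃ N : Set (Transversality.E n × Matrix (Fin n) (Fin n) ℝ),
      IsMeagre N ∧ Transversality.IsLebesgueNull N ∧
      ∀ (y : Transversality.E n) (K : Matrix (Fin n) (Fin n) ℝ), (y, K) ∉ N →
        Transversality.SatisfiesTransversality X T (Transversality.perturb F y K) := by
  exact Transversality.exists_isMeagre_null_forall_satisfiesTransversality hX
    (hF.of_le (by norm_num))
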